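/- Let $\mathcal S$ be the category of complex super vector spaces, i.e. of left modules over $\mathbb{C}\mathbb{Z}_2$ ($\mathbb{Z}_2=\{1,g\}$), with even maps; for $V=V_0\oplus V_1$ the generator $g$ acts by $(-1)^d$ on $V_d$. It is symmetric monoidal with the diagonal action on $V\otimes W$ and the braiding $\psi$ given by the $R$-matrix $R=\frac12(1\otimes1+1\otimes g+g\otimes1-g\otimes g)$, i.e. $\psi(v\otimes w)=(-1)^{|v||w|}w\otimes v$ on homogeneous vectors. Let $H=H_0\oplus H_1$ be a super Hopf algebra, i.e. a Hopf algebra $(H,m,\eta,\Delta,\varepsilon,S)$ in $\mathcal S$. Let $(\delta,\sigma)$ be a braided modular pair in involution: $\delta:H\to\mathbb{C}$ is an even algebra map, $\sigma:\mathbb{C}\to H$ is an even coalgebra map (we also write $\sigma$ for $\sigma(1)\in H$), $\delta\sigma=\mathrm{id}$, and $m(m\otimes \mathrm{id})(S\sigma\otimes\widetilde S^2\otimes\sigma)=\mathrm{id}_H$, where $\widetilde S=(\delta\otimes S)\Delta$. The braided Connes–Moscovici complex of $(H,\delta,\sigma)$ is defined, by formulas that make sense in any braided monoidal category with unit object $I$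 (here $I=\mathbb{C}$), by $C^0(H)=I$, $C^n(H)=H^{n}:=H^{\otimes n}$ for $n\ge1$, with * faces $\delta_i:C^{n-1}(H)\to C^n(H)$, $n\ge1$, $0\le i\le n$: $\delta_0=(\eta,1,\dots,1)$, $\delta_i=(1,\dots,1,\Delta,1,\dots,1)$ with $\Delta$ at the $i$-th place for $1\le i\le n-1$, and $\delta_n=(1,\dots,1,\sigma)$; * degeneracies $\sigma_i:C^{n+1}(H)\to C^n(H)$, $0\le i\le n$: $\sigma_i=(1,\dots,1,\varepsilon,1,\dots,1)$ with $\varepsilon$ at the $(i+1)$-st place; * cyclic maps $\tau_0=\mathrm{id}$ and $\tau_n=m_n(\Delta^{n-1}\widetilde S,1_{H^{n-1}},\sigma)$ for $n\ge 1$, where $m_n=(m,\dots,m)\,\mathcal F_n(\psi):H^n\otimes H^n\to H^n$ with $n$ copies of $m$, and $\mathcal F_n(\psi)=\prod_{j=1}^{n-1}(1_{H^j},\underbrace{\psi,\dots,\psi}_{n-j},1_{H^j})$ is a composition of maps, the factor $j=n-1$ being applied first. Then, writing $(h_1,\dots,h_n)=h_1\otimes\cdots\otimes h_n$, these are given explicitly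 as follows. One has $C^0(H)=\mathbb{C}$, and $C^n(H)$ is the $n$-th tensor power of the vector space $H$. For all elements of $H$, $$\delta_i(h_1,\dots,h_{n-1})=\begin{cases}(1,h_1,\dots,h_{n-1}) & i=0\\ (h_1,\dots,h_i^{(1)},h_i^{(2)},\dots,h_{n-1}) & 1\le i\le n-1\\ (h_1,\dots,h_{n-1},\sigma) & i=n,\end{cases}$$ $$\sigma_i(h_1,\dots,h_{n+1})=\varepsilon(h_{i+1})\,(h_1,\dots,h_i,h_{i+2},\dots,h_{n+1}),\qquad 0\le i\le n,$$ and $\tau_0=\mathrm{id}$. Moreover, every $\Delta^{n-1}(a)$, $a\in H$, $n\ge 1$, is a finite sum $\sum a^{(1)}\otimes\cdots\otimes a^{(n)}$ with homogeneous entries, and for $n\ge1$, homogeneous $h_1,\dots,h_n$ and every such expansion $\Delta^{n-1}(h_1)=\sum h_1^{(1)}\otimes\cdots\otimes h_1^{(n)}$, $$\tau_n(h_1,\dots,h_n)=\sum\alpha\beta\,\bigl(S(h_1^{(n)})h_2,\,S(h_1^{(n-1)})h_3,\dots,S(h_1^{(2)})h_n,\,\widetilde S(h_1^{(1)})\sigma\bigr),$$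 $$\alpha=\prod_{i=1}^{n-1}(-1)^{(|h_1^{(1)}|+\cdots+|h_1^{(i)}|)\,|h_1^{(i+1)}|},\qquad \beta=\prod_{j=1}^{n-1}(-1)^{|h_1^{(j)}|\,(|h_2|+|h_3|+\cdots+|h_{n-j+1}|)}.$$ -/

import Mathlib

open CategoryTheory MonoidalCategory
open scoped TensorProduct MonObj ComonObj

/-! ### The braided monoidal category of super vector spaces -/

/-- A complex super vector space, given as a module over the group algebra of the cyclic group of
order two: a complex vector space with an involution `parity` (the action of the generator). -/
structure SuperSpace where
  carrier : Type
  [addCommGroup : AddCommGroup carrier]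
  [module : Module ℂ carrier]
  parity : carrier →ₗ[ℂ] carrier
  parity_parity : ∀ v, parity (parity v) = v

namespace SuperSpace

instance : CoeSort SuperSpace Type := ⟨carrier⟩

attribute [instance] addCommGroup module

/-- The homogeneous part of degree `d`: the vectors on which `parity` acts as `(-1) ^ d`. -/
def homogeneous (V : SuperSpace) (d : ZMod 2) : Submodule ℂ V :=
  Module.End.eigenspace V.parity ((-1) ^ d.val)

/-- An even linear map. -/
@[ext]
structure Hom (V W : SuperSpace) where
  toLin : V →ₗ[ℂ] W
  parity_toLin : ∀ v, W.parity (toLin v) = toLin (V.parity v)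

instance : Category SuperSpace where
  Hom := Hom
  id V := ⟨LinearMap.id, fun _ => rfl⟩
  comp f g := ⟨g.toLin ∘ₗ f.toLin, fun v => by
    simp [f.parity_toLin, g.parity_toLin]⟩

instance (V W : SuperSpace) : CoeFun (V ⟶ W) (fun _ => V → W) := ⟨fun f => f.toLin⟩

@[ext]
theorem hom_ext {V W : SuperSpace} {f g : V ⟶ W} (h : f.toLin = g.toLin) : f = g :=
  Hom.ext h

@[simp] theorem id_toLin (V : SuperSpace) : Hom.toLin (𝟙 V) = LinearMap.id := rfl

@[simp] theorem comp_toLin {U V W : SuperSpace} (f : U ⟶ V) (g : V ⟶ W) :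
    (f ≫ g).toLin = g.toLin ∘ₗ f.toLin := rfl

/-- An isomorphism from a linear equivalence that commutes with the parities. -/
def isoMk {V W : SuperSpace} (e : V ≃ₗ[ℂ] W) (h : ∀ v, W.parity (e v) = e (V.parity v)) :
    V ≅ W where
  hom := ⟨e.toLinearMap, h⟩
  inv := ⟨e.symm.toLinearMap, fun w => by
    apply e.injective
    simp [← h]⟩
  hom_inv_id := by ext; simp
  inv_hom_id := by ext; simp

/-- The tensor product: the generator acts diagonally. -/
abbrev tensor (V W : SuperSpace) : SuperSpace where
  carrier := V ⊗[ℂ] W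
  parity := TensorProduct.map V.parity W.parity
  parity_parity v := by
    induction v using TensorProduct.induction_on with
    | zero => simp
    | tmul x y => simp [parity_parity]
    | add x y hx hy => rw [map_add, map_add, hx, hy]

/-- The unit object: `ℂ` with the trivial action. -/
abbrev unitSpace : SuperSpace where
  carrier := ℂ
  parity := LinearMap.id
  parity_parity _ := rfl

/-- The tensor product of even maps. -/
def tensorMap {V W V' W' : SuperSpace} (f : V ⟶ W) (g : V' ⟶ W') :
    tensor V V' ⟶ tensor W W' where
  toLin := TensorProduct.map f.toLin g.toLin
  parity_toLin v := by
    change TensorProduct.map W.parity W'.parity (TensorProduct.map f.toLin g.toLin v) =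
      TensorProduct.map f.toLin g.toLin (TensorProduct.map V.parity V'.parity v)
    induction v using TensorProduct.induction_on with
    | zero => simp
    | tmul x y => simp [f.parity_toLin, g.parity_toLin]
    | add x y hx hy => simp only [map_add, hx, hy]

instance : MonoidalCategoryStruct SuperSpace where
  tensorObj := tensor
  tensorUnit := unitSpace
  tensorHom := tensorMap
  whiskerLeft X _ _ f := tensorMap (𝟙 X) f
  whiskerRight f Y := tensorMap f (𝟙 Y)
  associator U V W := isoMk (TensorProduct.assoc ℂ U V W) <| LinearMap.congr_fun
    (f := TensorProduct.map U.parity (TensorProduct.map V.parity W.parity) ∘ₗ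
      (TensorProduct.assoc ℂ U V W).toLinearMap)
    (g := (TensorProduct.assoc ℂ U V W).toLinearMap ∘ₗ
      TensorProduct.map (TensorProduct.map U.parity V.parity) W.parity)
    (TensorProduct.ext_threefold fun _ _ _ => rfl)
  leftUnitor V := isoMk (TensorProduct.lid ℂ V) <| LinearMap.congr_fun
    (f := V.parity ∘ₗ (TensorProduct.lid ℂ V).toLinearMap)
    (g := (TensorProduct.lid ℂ V).toLinearMap ∘ₗ TensorProduct.map LinearMap.id V.parity)
    (TensorProduct.ext' fun a y => V.parity.map_smul a y)
  rightUnitor V := isoMk (TensorProduct.rid ℂ V) <| LinearMap.congr_fun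
    (f := V.parity ∘ₗ (TensorProduct.rid ℂ V).toLinearMap)
    (g := (TensorProduct.rid ℂ V).toLinearMap ∘ₗ TensorProduct.map V.parity LinearMap.id)
    (TensorProduct.ext' fun x a => V.parity.map_smul a x)

instance : MonoidalCategory SuperSpace := MonoidalCategory.ofTensorHom
  (id_tensorHom_id := fun _ _ => hom_ext TensorProduct.map_id)
  (id_tensorHom := fun _ _ _ _ => rfl)
  (tensorHom_id := fun _ _ => rfl)
  (tensorHom_comp_tensorHom := fun _ _ _ _ => hom_ext (TensorProduct.map_comp _ _ _ _).symm)
  (associator_naturality := fun _ _ _ => hom_ext (TensorProduct.ext_threefold fun _ _ _ => rfl))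
  (leftUnitor_naturality := fun f => hom_ext (TensorProduct.ext' fun a y =>
    (f.toLin.map_smul a y).symm))
  (rightUnitor_naturality := fun f => hom_ext (TensorProduct.ext' fun x a =>
    (f.toLin.map_smul a x).symm))
  (pentagon := fun _ _ _ _ => hom_ext (TensorProduct.ext_fourfold fun _ _ _ _ => rfl))
  (triangle := fun X Y => hom_ext (TensorProduct.ext_threefold fun x a y =>
    (TensorProduct.smul_tmul (R := ℂ) (R' := ℂ) (M := X) (N := Y) a x y).symm))

/-- The braiding `v ⊗ w ↦ (R₂ w) ⊗ (R₁ v)` for the universal `R`-matrix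
`R = (1 ⊗ 1 + 1 ⊗ g + g ⊗ 1 - g ⊗ g) / 2`, where `g` acts by `parity`. -/
noncomputable def braidLin (V W : SuperSpace) : V ⊗[ℂ] W →ₗ[ℂ] W ⊗[ℂ] V :=
  (2⁻¹ : ℂ) •
    (TensorProduct.map LinearMap.id LinearMap.id + TensorProduct.map W.parity LinearMap.id +
      TensorProduct.map LinearMap.id V.parity - TensorProduct.map W.parity V.parity) ∘ₗ
    (TensorProduct.comm ℂ V W).toLinearMap

theorem braidLin_tmul (V W : SuperSpace) (v : V) (w : W) :
    braidLin V W (v ⊗ₜ w) = (2⁻¹ : ℂ) • (w ⊗ₜ[ℂ] v + W.parity w ⊗ₜ[ℂ] v +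
      w ⊗ₜ[ℂ] V.parity v - W.parity w ⊗ₜ[ℂ] V.parity v) := by
  simp [braidLin]

/-- On homogeneous vectors the braiding is the flip with the Koszul sign. -/
theorem braidLin_homogeneous (V W : SuperSpace) {a b : ZMod 2} {v : V} {w : W}
    (hv : v ∈ V.homogeneous a) (hw : w ∈ W.homogeneous b) :
    braidLin V W (v ⊗ₜ w) = (-1 : ℂ) ^ (a * b).val • w ⊗ₜ[ℂ] v := by
  rw [homogeneous, Module.End.mem_eigenspace_iff] at hv hw
  rw [braidLin_tmul, hv, hw]
  simp only [TensorProduct.smul_tmul', TensorProduct.tmul_smul]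
  have h2 : ∀ c : ZMod 2, c = 0 ∨ c = 1 := by decide
  rcases h2 a with rfl | rfl <;> rcases h2 b with rfl | rfl <;>
    simp [ZMod.val_one] <;> module

theorem braidLin_braidLin (V W : SuperSpace) (x : V ⊗[ℂ] W) :
    braidLin W V (braidLin V W x) = x := by
  induction x using TensorProduct.induction_on with
  | zero => simp
  | tmul v w =>
    simp only [braidLin_tmul, map_smul, map_add, map_sub, parity_parity]
    module
  | add x y hx hy => simp only [map_add, hx, hy]

/-- The braiding as an isomorphism of super vector spaces. -/
noncomputable def braid (V W : SuperSpace) : tensor V W ≅ tensor W V :=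
  isoMk (LinearEquiv.ofLinearMap (braidLin V W) (braidLin W V)
    (LinearMap.ext (braidLin_braidLin W V)) (LinearMap.ext (braidLin_braidLin V W))) fun x => by
      change TensorProduct.map W.parity V.parity (braidLin V W x) =
        braidLin V W (TensorProduct.map V.parity W.parity x)
      induction x using TensorProduct.induction_on with
      | zero => simp
      | tmul v w =>
        simp only [braidLin_tmul, map_smul, map_add, map_sub, parity_parity,
          TensorProduct.map_tmul]
      | add x y hx hy => simp only [map_add, hx, hy]

noncomputable instance : SymmetricCategory SuperSpace where
  braiding := braid
  braiding_naturality_right X Y Z f := hom_ext <| TensorProduct.ext' fun x y => by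
    change braidLin X Z (x ⊗ₜ f y) = TensorProduct.map f.toLin LinearMap.id (braidLin X Y (x ⊗ₜ y))
    simp only [braidLin_tmul, map_smul, map_add, map_sub, TensorProduct.map_tmul,
      LinearMap.id_apply, f.parity_toLin]
  braiding_naturality_left {X Y} f Z := hom_ext <| TensorProduct.ext' fun x z => by
    change braidLin Y Z (f x ⊗ₜ z) = TensorProduct.map LinearMap.id f.toLin (braidLin X Z (x ⊗ₜ z))
    simp only [braidLin_tmul, map_smul, map_add, map_sub, TensorProduct.map_tmul,
      LinearMap.id_apply, f.parity_toLin]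
  hexagon_forward X Y Z := hom_ext <| TensorProduct.ext_threefold fun x y z => by
    refine (congrArg (TensorProduct.assoc ℂ Y Z X)
      (braidLin_tmul X (tensor Y Z) x (y ⊗ₜ z))).trans ?_
    change TensorProduct.assoc ℂ Y Z X ((2⁻¹ : ℂ) • ((y ⊗ₜ[ℂ] z) ⊗ₜ[ℂ] x +
        (Y.parity y ⊗ₜ[ℂ] Z.parity z) ⊗ₜ[ℂ] x + (y ⊗ₜ[ℂ] z) ⊗ₜ[ℂ] X.parity x -
        (Y.parity y ⊗ₜ[ℂ] Z.parity z) ⊗ₜ[ℂ] X.parity x)) =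
      TensorProduct.map LinearMap.id (braidLin X Z) (TensorProduct.assoc ℂ Y X Z
        (braidLin X Y (x ⊗ₜ y) ⊗ₜ z))
    simp only [braidLin_tmul, map_smul, map_add, map_sub, TensorProduct.map_tmul,
      LinearMap.id_apply, TensorProduct.assoc_tmul, ← TensorProduct.smul_tmul',
      TensorProduct.add_tmul, TensorProduct.sub_tmul, TensorProduct.tmul_smul,
      TensorProduct.tmul_add, TensorProduct.tmul_sub, parity_parity]
    module
  hexagon_reverse X Y Z := hom_ext <| TensorProduct.ext' fun x w => by
    induction w using TensorProduct.induction_on with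
    | zero => rw [TensorProduct.tmul_zero, map_zero, map_zero]
    | tmul y z =>
      refine (congrArg (TensorProduct.assoc ℂ Z X Y).symm
        (braidLin_tmul (tensor X Y) Z (x ⊗ₜ y) z)).trans ?_
      change (TensorProduct.assoc ℂ Z X Y).symm ((2⁻¹ : ℂ) • (z ⊗ₜ[ℂ] (x ⊗ₜ[ℂ] y) +
          Z.parity z ⊗ₜ[ℂ] (x ⊗ₜ[ℂ] y) + z ⊗ₜ[ℂ] (X.parity x ⊗ₜ[ℂ] Y.parity y) -
          Z.parity z ⊗ₜ[ℂ] (X.parity x ⊗ₜ[ℂ] Y.parity y))) =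
        TensorProduct.map (braidLin X Z) LinearMap.id ((TensorProduct.assoc ℂ X Z Y).symm
          (x ⊗ₜ braidLin Y Z (y ⊗ₜ z)))
      simp only [braidLin_tmul, map_smul, map_add, map_sub, TensorProduct.map_tmul,
        LinearMap.id_apply, TensorProduct.assoc_symm_tmul, ← TensorProduct.smul_tmul',
        TensorProduct.add_tmul, TensorProduct.sub_tmul, TensorProduct.tmul_smul,
        TensorProduct.tmul_add, TensorProduct.tmul_sub, parity_parity]
      module
    | add y z hy hz => rw [TensorProduct.tmul_add, map_add, map_add, hy, hz]
  symmetry X Y := hom_ext <| LinearMap.ext (braidLin_braidLin X Y)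

end SuperSpace

/-! ### The braided Connes-Moscovici complex

Here `H` is a Hopf algebra in a braided monoidal category with braiding `ψ = β_`. -/

namespace ConnesMoscovici

universe v u

section

variable {C : Type u} [Category.{v} C] [MonoidalCategory C] (H : C)

/-- The object `Cⁿ(H) = Hⁿ`, with `H⁰ = I` and `Hⁿ⁺¹ = H ⊗ Hⁿ`. -/
def obj : ℕ → C
  | 0 => 𝟙_ C
  | n + 1 => H ⊗ obj n

/-- `(1, …, 1, σ)`. -/
def snocCochar (σ : 𝟙_ C ⟶ H) : (n : ℕ) → (obj H n ⟶ obj H (n + 1))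
  | 0 => σ ≫ (ρ_ H).inv
  | n + 1 => H ◁ snocCochar σ n

/-- Juxtaposition of tensor powers, `Hᵐ ⊗ Hⁿ ⟶ Hⁿ⁺ᵐ`. -/
def concat : (m n : ℕ) → (obj H m ⊗ obj H n ⟶ obj H (n + m))
  | 0, n => (λ_ (obj H n)).hom
  | m + 1, n => (α_ H (obj H m) (obj H n)).hom ≫ H ◁ concat m n

variable [BraidedCategory C]

/-- `(1_{Hʲ}, ψ, …, ψ, 1)` on `Hᴺ`, with `k` copies of `ψ = ψ_{H,H}` and identities on the
remaining factors; used only for `j + 2 * k ≤ N`. -/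
def braidLayer : (j k N : ℕ) → (obj H N ⟶ obj H N)
  | 0, k + 1, N + 2 => (α_ H H (obj H N)).inv ≫
      ((β_ H H).hom ⊗ₘ braidLayer 0 k N) ≫ (α_ H H (obj H N)).hom
  | j + 1, k, N + 1 => H ◁ braidLayer j k N
  | _, _, _ => 𝟙 _

/-- `F_n(ψ) = ∏_{j=1}^{n-1} (1_{Hʲ}, ψ, …, ψ, 1_{Hʲ})`, with `n - j` copies of `ψ` in the `j`-th
term, on `H²ⁿ`. The product is composition of maps, the term `j = n - 1` being applied first. -/
def shuffle (n : ℕ) : End (obj H (n + n)) :=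
  ((List.range (n - 1)).map fun i =>
    (show End (obj H (n + n)) from braidLayer H (i + 1) (n - (i + 1)) (n + n))).prod

variable [HopfObj H]

/-- The `δ`-twisted antipode `(δ ⊗ S) Δ`. -/
def twistedAntipode (δ : H ⟶ 𝟙_ C) : H ⟶ H :=
  Δ[H] ≫ (δ ⊗ₘ HopfObj.antipode (X := H)) ≫ (λ_ H).hom

/-- `(δ, σ)` is a braided modular pair in involution: `δ` is an algebra map, `σ` is a coalgebra
map, `δ σ = id`, and `m (m ⊗ id) (S σ ⊗ S̃² ⊗ σ) = id`. -/
structure IsBraidedMPI (δ : H ⟶ 𝟙_ C) (σ : 𝟙_ C ⟶ H) : Prop where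
  mul_char : μ[H] ≫ δ = (δ ⊗ₘ δ) ≫ (λ_ (𝟙_ C)).hom
  one_char : η[H] ≫ δ = 𝟙 (𝟙_ C)
  cochar_comul : σ ≫ Δ[H] = (λ_ (𝟙_ C)).inv ≫ (σ ⊗ₘ σ)
  cochar_counit : σ ≫ ε[H] = 𝟙 (𝟙_ C)
  cochar_char : σ ≫ δ = 𝟙 (𝟙_ C)
  involution :
    (ρ_ H).inv ≫ (λ_ H).inv ▷ 𝟙_ C ≫
      (((σ ≫ HopfObj.antipode (X := H)) ⊗ₘ
        (twistedAntipode H δ ≫ twistedAntipode H δ)) ⊗ₘ σ) ≫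
      μ[H] ▷ H ≫ μ[H] = 𝟙 H

/-- `(1, …, 1, Δ, 1, …, 1)` with `Δ` at the (zero-based) position `i`. -/
def comulAt : (n : ℕ) → Fin n → (obj H n ⟶ obj H (n + 1))
  | n + 1, ⟨0, _⟩ => Δ[H] ▷ obj H n ≫ (α_ H H (obj H n)).hom
  | n + 1, ⟨i + 1, h⟩ => H ◁ comulAt n ⟨i, Nat.lt_of_succ_lt_succ h⟩

/-- The faces `δ_i : Cⁿ(H) ⟶ Cⁿ⁺¹(H)`, `0 ≤ i ≤ n + 1`: `(η, 1, …, 1)` for `i = 0`,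
`(1, …, 1, σ)` for `i = n + 1`, and `Δ` at the `i`-th factor otherwise. -/
def face (σ : 𝟙_ C ⟶ H) (n : ℕ) (i : Fin (n + 2)) : obj H n ⟶ obj H (n + 1) :=
  Fin.cases ((λ_ (obj H n)).inv ≫ η[H] ▷ obj H n)
    (fun j => Fin.lastCases (snocCochar H σ n) (comulAt H n) j) i

/-- The degeneracies `σ_i : Cⁿ⁺¹(H) ⟶ Cⁿ(H)`, `0 ≤ i ≤ n`: `ε` at the `(i + 1)`-st factor. -/
def degeneracy : (n : ℕ) → Fin (n + 1) → (obj H (n + 1) ⟶ obj H n)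
  | n, ⟨0, _⟩ => ε[H] ▷ obj H n ≫ (λ_ (obj H n)).hom
  | n + 1, ⟨i + 1, h⟩ => H ◁ degeneracy n ⟨i, Nat.lt_of_succ_lt_succ h⟩

/-- The iterated comultiplication `Δⁿ : H ⟶ Hⁿ⁺¹`. -/
def iterComul : (n : ℕ) → (H ⟶ obj H (n + 1))
  | 0 => (ρ_ H).inv
  | n + 1 => Δ[H] ≫ H ◁ iterComul n

/-- `(m, …, m)` with `n` copies of `m`, on `Hᴺ` with `N = 2n`. -/
def mulPairs : (n N : ℕ) → N = n + n → (obj H N ⟶ obj H n)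
  | 0, 0, _ => 𝟙 _
  | n + 1, N + 2, h => (α_ H H (obj H N)).inv ≫ (μ[H] ⊗ₘ mulPairs n N (by omega))
  | 0, _ + 1, h => absurd h (by omega)
  | _ + 1, 0, h => absurd h (by omega)
  | _ + 1, 1, h => absurd h (by omega)

/-- `m_n = m_{Hⁿ} = (m, …, m) F_n(ψ) : Hⁿ ⊗ Hⁿ ⟶ Hⁿ`. -/
def mulPow (n : ℕ) : obj H n ⊗ obj H n ⟶ obj H n :=
  concat H n n ≫ shuffle H n ≫ mulPairs H n (n + n) rfl

/-- The cyclic maps: `τ_0 = id` and `τ_n = m_n (Δⁿ⁻¹ S̃, 1_{Hⁿ⁻¹}, σ)` for `n ≥ 1`. -/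
def cyclic (δ : H ⟶ 𝟙_ C) (σ : 𝟙_ C ⟶ H) : (n : ℕ) → (obj H n ⟶ obj H n)
  | 0 => 𝟙 _
  | n + 1 => ((twistedAntipode H δ ≫ iterComul H n) ⊗ₘ snocCochar H σ n) ≫ mulPow H (n + 1)

end

/-! ### Elements of the complex of a super Hopf algebra -/

section

variable (H : SuperSpace)

/-- The element `(h_1, …, h_n) = h_1 ⊗ ⋯ ⊗ h_n` of `Cⁿ(H)`. -/
def tensorElt : (n : ℕ) → (Fin n → H) → (obj (C := SuperSpace) H n).carrier
  | 0, _ => (1 : ℂ)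
  | n + 1, h => h 0 ⊗ₜ[ℂ] tensorElt n (Fin.tail h)

variable [HopfObj H]

/-- The product of two elements. -/
def mulElt (a b : H) : H := μ[H] (a ⊗ₜ[ℂ] b : H ⊗[ℂ] H)

/-- The comultiplication on elements. -/
def comulElt (a : H) : H ⊗[ℂ] H := Δ[H] a

/-- The counit on elements. -/
def counitElt (a : H) : ℂ := ε[H] a

/-- The element `1` of `H`. -/
def oneElt : H := η[H] (1 : ℂ)

end

/-- The element of `H` given by a map `σ : ℂ ⟶ H`. -/
def elt {H : SuperSpace} (σ : 𝟙_ SuperSpace ⟶ H) : H := σ (1 : ℂ)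

/-- The sign `α = ∏_{i=1}^{n-1} (-1)^{(|x_1| + ⋯ + |x_i|) |x_{i+1}|}`, for `n + 1` in place of
`n` and zero-based indices, where `e i` is the degree of the `i`-th entry. -/
def signAlpha {n : ℕ} (e : Fin (n + 1) → ZMod 2) : ℂ :=
  ∏ i : Fin n, (-1) ^ ((∑ j ∈ Finset.Iic i.castSucc, e j) * e i.succ).val

/-- The sign `β = ∏_{j=1}^{n-1} (-1)^{|x_j| (|h_2| + ⋯ + |h_{n-j+1}|)}`, for `n + 1` in place of
`n` and zero-based indices, where `e` and `d` are the degrees of the `x_j` and of the `h_l`. -/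
def signBeta {n : ℕ} (e d : Fin (n + 1) → ZMod 2) : ℂ :=
  ∏ j : Fin n, (-1) ^ (e j.castSucc * ∑ l ∈ Finset.Ioc 0 j.castSucc.rev, d l).val

end ConnesMoscovici

/-! Faces and degeneracies are read off on pure tensors; all the content lies in the cyclic map,
where the signs come from two independent sources. The sign α comes from reversal. The antipode is
anticomultiplicative up to the braiding, and coassociativity gives the twisted antipode the mixed
rule Δ S̃ = (S ⊗ S̃) ψ Δ (`twistedAntipode_comul`). Iterated, this turns Δⁿ S̃ into Δⁿ followed by a
braided reversal with S on every factor except a⁽¹⁾, which receives S̃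
(`twistedAntipode_iterComul`). In the reversal each a⁽ⁱ⁺¹⁾ crosses the whole block a⁽¹⁾ ⊗ ⋯ ⊗ a⁽ⁱ⁾,
and these Koszul signs multiply to α (`twistedReverse_seqElt`). The sign β comes from the product on
Hⁿ. The layers of ψ turn y₀ … yₙ z₀ … zₙ into y₀ z₀ … yₙ zₙ, and y_p crosses exactly the z_i with i
< p (`braidLayers_seqElt`, `mulPow_seqElt`). Here y_p comes from the reversed factor with zero-based
index n - p, and regrouping the crossings by that index gives β (`signBeta_eq`). The entry σ stands
last and crosses nothing. Computations use ℕ-indexed sequences of which only an initial segment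
matters, so shifts of position need no `Fin` casts. -/

namespace ConnesMoscovici

universe v u

/-! ### The iterated comultiplication and the twisted antipode -/

section

variable {C : Type u} [Category.{v} C] [MonoidalCategory C] (H : C)

/-- Splitting off the last tensor factor: `Hⁿ⁺¹ ⟶ Hⁿ ⊗ H`. -/
def splitLast : (n : ℕ) → (obj H (n + 1) ⟶ obj H n ⊗ H)
  | 0 => (ρ_ H).hom ≫ (λ_ H).inv
  | n + 1 => H ◁ splitLast n ≫ (α_ H (obj H n) H).inv

variable [BraidedCategory C] [HopfObj H]

/-- Coassociativity: the iterated comultiplication is built by splitting the last leg, but may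
equally be built by splitting the first. The second form suits the reversal, which peels factors off
the right end. -/
theorem iterComul_splitLast (n : ℕ) :
    iterComul H (n + 1) ≫ splitLast H (n + 1) = Δ[H] ≫ iterComul H n ▷ H := by
  induction n with
  | zero =>
    change (Δ[H] ≫ H ◁ (ρ_ H).inv) ≫ H ◁ ((ρ_ H).hom ≫ (λ_ H).inv) ≫ (α_ H (𝟙_ C) H).inv =
      Δ[H] ≫ (ρ_ H).inv ▷ H
    simp
  | succ n ih =>
    change (Δ[H] ≫ H ◁ iterComul H (n + 1)) ≫ H ◁ splitLast H (n + 1) ≫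
      (α_ H (obj H (n + 1)) H).inv = Δ[H] ≫ (Δ[H] ≫ H ◁ iterComul H n) ▷ H
    rw [Category.assoc, ← whiskerLeft_comp_assoc, ih]
    simp [ComonObj.comul_assoc_assoc]

theorem twistedAntipode_eq (δ : H ⟶ 𝟙_ C) :
    twistedAntipode H δ = Δ[H] ≫ δ ▷ H ≫ (λ_ H).hom ≫ HopfObj.antipode (X := H) := by
  simp only [twistedAntipode, MonoidalCategory.tensorHom_def, Category.assoc,
    leftUnitor_naturality]

/-- In Sweedler notation without signs, Δ(δ(a₁) S(a₂)) = δ(a₁) S(a₃) ⊗ S(a₂) = S(a₂) ⊗ S̃(a₁). The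
contraction with δ passes through the braiding by naturality. -/
theorem twistedAntipode_comul (δ : H ⟶ 𝟙_ C) :
    twistedAntipode H δ ≫ Δ[H] =
      Δ[H] ≫ (β_ H H).hom ≫ (HopfObj.antipode (X := H) ⊗ₘ twistedAntipode H δ) := by
  have h : (β_ H H).hom ≫ (HopfObj.antipode (X := H) ⊗ₘ twistedAntipode H δ) =
      (Δ[H] ≫ δ ▷ H ≫ (λ_ H).hom) ▷ H ≫ (β_ H H).hom ≫
        (HopfObj.antipode (X := H) ⊗ₘ HopfObj.antipode (X := H)) := by
    rw [BraidedCategory.braiding_naturality_left_assoc, twistedAntipode_eq,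
      MonoidalCategory.tensorHom_def', MonoidalCategory.tensorHom_def']
    simp only [whiskerLeft_comp, Category.assoc]
  rw [h, twistedAntipode_eq]
  simp only [Category.assoc, HopfObj.antipode_comul, comp_whiskerRight]
  -- Coassociativity trades splitting the second leg for splitting the first, so that δ contracts
  -- against the leg that is to carry S̃.
  rw [← leftUnitor_naturality_assoc, ← whisker_exchange_assoc, ComonObj.comul_assoc_flip_assoc]
  simp

/-- The reversal of the factors of `Hⁿ⁺¹` by means of the braiding, with the antipode applied to
all factors but the first, and the twisted antipode applied to the first one. -/
def twistedReverse (δ : H ⟶ 𝟙_ C) : (n : ℕ) → (obj H (n + 1) ⟶ obj H (n + 1))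
  | 0 => twistedAntipode H δ ▷ 𝟙_ C
  | n + 1 => splitLast H (n + 1) ≫ (β_ (obj H (n + 1)) H).hom ≫
      (HopfObj.antipode (X := H) ⊗ₘ twistedReverse δ n)

theorem twistedAntipode_iterComul (δ : H ⟶ 𝟙_ C) (n : ℕ) :
    twistedAntipode H δ ≫ iterComul H n = iterComul H n ≫ twistedReverse H δ n := by
  induction n with
  | zero => exact (rightUnitor_inv_naturality _)
  | succ n ih =>
    change twistedAntipode H δ ≫ Δ[H] ≫ H ◁ iterComul H n = iterComul H (n + 1) ≫
      splitLast H (n + 1) ≫ (β_ (obj H (n + 1)) H).hom ≫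
      (HopfObj.antipode (X := H) ⊗ₘ twistedReverse H δ n)
    rw [← Category.assoc (iterComul H (n + 1)), iterComul_splitLast, Category.assoc,
      BraidedCategory.braiding_naturality_left_assoc, ← Category.assoc, twistedAntipode_comul,
      Category.assoc, Category.assoc, MonoidalCategory.tensorHom_def',
      MonoidalCategory.tensorHom_def', ← whiskerLeft_comp_assoc, ← ih]
    simp [← whisker_exchange]

end

/-! ### Elements -/

section

variable (H : SuperSpace)

/-- The object `Hⁿ` is the `n`-th tensor power of the vector space `H`. -/
noncomputable def objEquiv : (n : ℕ) →
    { e : (obj (C := SuperSpace) H n).carrier ≃ₗ[ℂ] (⨂[ℂ] _ : Fin n, H) //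
      ∀ h : Fin n → H, e (tensorElt H n h) = PiTensorProduct.tprod ℂ h }
  | 0 => ⟨(PiTensorProduct.isEmptyEquiv (Fin 0)).symm, fun h => by
      exact (LinearEquiv.symm_apply_eq _).2
        (PiTensorProduct.isEmptyEquiv_apply_tprod (R := ℂ) (Fin 0) h).symm⟩
  | n + 1 => ⟨(TensorProduct.congr (PiTensorProduct.subsingletonEquiv (R := ℂ)
        (s := fun _ : Unit => H.carrier) ()).symm (objEquiv n).1).trans
      ((PiTensorProduct.tmulEquiv ℂ H).trans (PiTensorProduct.reindex ℂ (fun _ => H.carrier)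
        -- The index in `Unit` is sent to `none` and hence to `0`, so the new factor becomes the
        -- first one.
        (((Equiv.sumComm _ _).trans (Equiv.optionEquivSumPUnit (Fin n)).symm).trans
          (finSuccEquiv n).symm))), fun h => by
      change (PiTensorProduct.reindex ℂ _ _) (PiTensorProduct.tmulEquiv ℂ H
        ((PiTensorProduct.subsingletonEquiv (R := ℂ)
          (s := fun _ : Unit => H.carrier) ()).symm (h 0) ⊗ₜ
            (objEquiv n).1 (tensorElt H n (Fin.tail h)))) = _
      rw [(objEquiv n).2, PiTensorProduct.subsingletonEquiv_symm_apply,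
        PiTensorProduct.tmulEquiv_apply, PiTensorProduct.reindex_tprod]
      congr 1
      ext i
      induction i using Fin.cases <;> simp [Fin.tail]⟩

variable {H}

theorem face_zero_tensorElt [HopfObj H] (σ : 𝟙_ SuperSpace ⟶ H) (n : ℕ) (h : Fin n → H) :
    face H σ n 0 (tensorElt H n h) =
      tensorElt H (n + 1) (Fin.cons (oneElt H) h : Fin (n + 1) → H) := rfl

/-- Overwriting entry i by the second leg and then inserting the first leg just before it places the
two legs side by side, with all later entries shifted by one. -/
theorem comulAt_tensorElt [HopfObj H] : ∀ (n : ℕ) (h : Fin n → H) (i : Fin n) (r : ℕ)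
    (x y : Fin r → H), comulElt H (h i) = ∑ k, x k ⊗ₜ[ℂ] y k →
    comulAt H n i (tensorElt H n h) = ∑ k, tensorElt H (n + 1)
      (i.castSucc.insertNth (x k) (Function.update h i (y k)) : Fin (n + 1) → H)
  | n + 1, h, ⟨0, _⟩, r, x, y, hxy => by
    change TensorProduct.assoc ℂ H H (obj (C := SuperSpace) H n).carrier
      (comulElt H (h 0) ⊗ₜ tensorElt H n (Fin.tail h)) = _
    erw [hxy]
    rw [TensorProduct.sum_tmul, map_sum]
    refine Finset.sum_congr rfl fun k _ => ?_
    rw [TensorProduct.assoc_tmul]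
    refine congrArg (tensorElt H (n + 2)) (?_ :
      (Fin.cons (x k) (Fin.cons (y k) (Fin.tail h)) : Fin (n + 2) → H) = _)
    ext i
    induction i using Fin.cases with
    | zero => rfl
    | succ i => induction i using Fin.cases <;> rfl
  | n + 1, h, ⟨i + 1, hi⟩, r, x, y, hxy => by
    have ih := comulAt_tensorElt n (Fin.tail h) ⟨i, Nat.lt_of_succ_lt_succ hi⟩ r x y hxy
    change h 0 ⊗ₜ[ℂ] comulAt H n ⟨i, Nat.lt_of_succ_lt_succ hi⟩ (tensorElt H n (Fin.tail h)) = _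
    rw [ih]
    erw [TensorProduct.tmul_sum]
    refine Finset.sum_congr rfl fun k _ => congrArg (tensorElt H (n + 2)) (?_ :
      (Fin.cons (h 0) ((Fin.castSucc ⟨i, Nat.lt_of_succ_lt_succ hi⟩).insertNth (x k)
        (Function.update (Fin.tail h) ⟨i, Nat.lt_of_succ_lt_succ hi⟩ (y k))) :
          Fin (n + 2) → H) = _)
    refine Fin.eq_insertNth_iff.2 ⟨?_, ?_⟩
    · exact Fin.insertNth_apply_same (α := fun _ => H.carrier)
        (Fin.castSucc ⟨i, Nat.lt_of_succ_lt_succ hi⟩) (x k) _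
    · have hsucc : (⟨i + 1, hi⟩ : Fin (n + 1)) = Fin.succ ⟨i, Nat.lt_of_succ_lt_succ hi⟩ := rfl
      rw [hsucc]
      generalize (⟨i, Nat.lt_of_succ_lt_succ hi⟩ : Fin n) = p
      ext j
      induction j using Fin.cases with
      | zero => simp [Fin.removeNth, (Fin.succ_ne_zero p).symm]
      | succ j =>
        simp only [Fin.removeNth, ← Fin.succ_castSucc, Fin.succ_succAbove_succ, Fin.cons_succ,
          Fin.insertNth_apply_succAbove]
        simp [Function.update_apply, Fin.tail]

theorem snocCochar_tensorElt (σ : 𝟙_ SuperSpace ⟶ H) (n : ℕ) (h : Fin n → H) :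
    snocCochar H σ n (tensorElt H n h) =
      tensorElt H (n + 1) (Fin.snoc h (elt σ) : Fin (n + 1) → H) := by
  induction n with
  | zero => rfl
  | succ n ih =>
    change h 0 ⊗ₜ[ℂ] snocCochar H σ n (tensorElt H n (Fin.tail h)) = _
    rw [ih]
    refine congrArg (tensorElt H (n + 2)) (?_ :
      (Fin.cons (h 0) (Fin.snoc (Fin.tail h) (elt σ)) : Fin (n + 2) → H) = _)
    rw [Fin.cons_snoc_eq_snoc_cons, Fin.cons_self_tail]

theorem degeneracy_tensorElt [HopfObj H] (n : ℕ) (h : Fin (n + 1) → H) (i : Fin (n + 1)) :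
    degeneracy H n i (tensorElt H (n + 1) h) =
      counitElt H (h i) • tensorElt H n (i.removeNth h) := by
  induction n with
  | zero =>
    obtain rfl := Fin.fin_one_eq_zero i
    rfl
  | succ n ih =>
    induction i using Fin.cases with
    | zero => rfl
    | succ i =>
      change h 0 ⊗ₜ[ℂ] degeneracy H n i (tensorElt H (n + 1) (Fin.tail h)) = _
      rw [ih]
      erw [TensorProduct.tmul_smul]
      refine congrArg (counitElt H (h i.succ) • ·) (congrArg (tensorElt H (n + 1)) (?_ :
        (Fin.cons (h 0) (i.removeNth (Fin.tail h)) : Fin (n + 1) → H) = _))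
      ext j
      induction j using Fin.cases <;> simp [Fin.removeNth, Fin.tail]

/-- Every vector v is the sum of its even part (v + gv)/2 and its odd part (v - gv)/2; apply this in
each factor and expand. -/
theorem span_homogeneous_tensorElt (n : ℕ) :
    Submodule.span ℂ {t | ∃ (x : Fin n → H) (e : Fin n → ZMod 2),
      (∀ j, x j ∈ H.homogeneous (e j)) ∧ tensorElt H n x = t} = ⊤ := by
  induction n with
  | zero =>
    refine Submodule.eq_top_iff'.2 fun (t : ℂ) => ?_
    have : t = t • (1 : ℂ) := by simp
    rw [this]
    exact Submodule.smul_mem _ _ (Submodule.subset_span ⟨Fin.elim0, Fin.elim0, nofun, rfl⟩)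
  | succ n ih =>
    refine Submodule.eq_top_iff'.2 fun (t : H ⊗[ℂ] (obj (C := SuperSpace) H n).carrier) => ?_
    induction t using TensorProduct.induction_on with
    | zero => exact Submodule.zero_mem _
    | add s t hs ht => exact Submodule.add_mem _ hs ht
    | tmul v t =>
      have key : ∀ (a : ZMod 2) (w : H), w ∈ H.homogeneous a →
          (w ⊗ₜ[ℂ] t : (obj (C := SuperSpace) H (n + 1)).carrier) ∈ Submodule.span ℂ
            {t | ∃ (x : Fin (n + 1) → H) (e : Fin (n + 1) → ZMod 2),
              (∀ j, x j ∈ H.homogeneous (e j)) ∧ tensorElt H (n + 1) x = t} := by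
        intro a w hw
        have ht : t ∈ Submodule.span ℂ {t | ∃ (x : Fin n → H) (e : Fin n → ZMod 2),
          (∀ j, x j ∈ H.homogeneous (e j)) ∧ tensorElt H n x = t} := ih ▸ Submodule.mem_top
        induction ht using Submodule.span_induction with
        | mem t h =>
          obtain ⟨x, e, hx, rfl⟩ := h
          refine Submodule.subset_span ⟨Fin.cons w x, Fin.cons a e, fun j => ?_, rfl⟩
          induction j using Fin.cases with
          | zero => exact hw
          | succ j => exact hx j
        | zero => erw [TensorProduct.tmul_zero]; exact Submodule.zero_mem _
        | add s t _ _ hs ht => erw [TensorProduct.tmul_add]; exact Submodule.add_mem _ hs ht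
        | smul c t _ ht => erw [TensorProduct.tmul_smul]; exact Submodule.smul_mem _ c ht
      have h₀ : (2⁻¹ : ℂ) • (v + H.parity v) ∈ H.homogeneous 0 := by
        rw [SuperSpace.homogeneous, Module.End.mem_eigenspace_iff]
        simp [SuperSpace.parity_parity, add_comm]
      have h₁ : (2⁻¹ : ℂ) • (v - H.parity v) ∈ H.homogeneous 1 := by
        rw [SuperSpace.homogeneous, Module.End.mem_eigenspace_iff]
        simp [SuperSpace.parity_parity, ZMod.val_one, ← smul_neg]
      have hv : v = (2⁻¹ : ℂ) • (v + H.parity v) + (2⁻¹ : ℂ) • (v - H.parity v) := by module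
      rw [hv, TensorProduct.add_tmul]
      exact Submodule.add_mem _ (key _ _ h₀) (key _ _ h₁)

theorem exists_homogeneous_expansion (n : ℕ) (a : (obj (C := SuperSpace) H (n + 1)).carrier) :
    ∃ (r : ℕ) (x : Fin r → Fin (n + 1) → H) (e : Fin r → Fin (n + 1) → ZMod 2),
      (∀ k j, x k j ∈ H.homogeneous (e k j)) ∧ a = ∑ k, tensorElt H (n + 1) (x k) := by
  have ha : a ∈ Submodule.span ℂ {t | ∃ (x : Fin (n + 1) → H) (e : Fin (n + 1) → ZMod 2),
      (∀ j, x j ∈ H.homogeneous (e j)) ∧ tensorElt H (n + 1) x = t} :=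
    span_homogeneous_tensorElt (H := H) (n + 1) ▸ Submodule.mem_top
  obtain ⟨r, c, g, rfl⟩ := Submodule.mem_span_set'.1 ha
  choose x e hx hxg using fun k => (g k).2
  -- The coefficient of each term is absorbed into its first entry, which requires at least one
  -- tensor factor.
  refine ⟨r, fun k => Fin.cons (c k • x k 0) (Fin.tail (x k)), e, fun k j => ?_,
    Finset.sum_congr rfl fun k _ => ?_⟩
  · induction j using Fin.cases with
    | zero => exact Submodule.smul_mem _ _ (hx k 0)
    | succ j => exact hx k j.succ
  · rw [← hxg k]
    rfl

end

end ConnesMoscovici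

/-! ### Koszul signs and degrees of homogeneous vectors. -/

namespace SuperSpace

theorem neg_one_pow_val_add (a b : ZMod 2) :
    (-1 : ℂ) ^ (a + b).val = (-1) ^ a.val * (-1) ^ b.val := by
  rw [← pow_add, neg_one_pow_eq_pow_mod_two, neg_one_pow_eq_pow_mod_two (n := a.val + b.val),
    ZMod.val_add, Nat.mod_mod]

theorem neg_one_pow_val_sum {κ : Type*} (s : Finset κ) (f : κ → ZMod 2) :
    (-1 : ℂ) ^ (∑ i ∈ s, f i).val = ∏ i ∈ s, (-1) ^ (f i).val := by
  classical
  induction s using Finset.induction_on with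
  | empty => simp
  | insert a s ha ih => rw [Finset.sum_insert ha, Finset.prod_insert ha, neg_one_pow_val_add, ih]

theorem apply_mem_homogeneous {V W : SuperSpace} (f : V ⟶ W) {a : ZMod 2} {v : V}
    (hv : v ∈ V.homogeneous a) : f v ∈ W.homogeneous a := by
  rw [homogeneous, Module.End.mem_eigenspace_iff] at hv ⊢
  rw [f.parity_toLin, hv, map_smul]

theorem tmul_mem_homogeneous {V W : SuperSpace} {a b : ZMod 2} {v : V} {w : W}
    (hv : v ∈ V.homogeneous a) (hw : w ∈ W.homogeneous b) :
    v ⊗ₜ[ℂ] w ∈ (tensor V W).homogeneous (a + b) := by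
  rw [homogeneous, Module.End.mem_eigenspace_iff] at hv hw ⊢
  change V.parity v ⊗ₜ[ℂ] W.parity w = _
  rw [hv, hw, TensorProduct.smul_tmul_smul, neg_one_pow_val_add]

end SuperSpace

/-! ### Reversal, shuffle and product on homogeneous pure tensors. -/

namespace ConnesMoscovici

open SuperSpace

variable {H : SuperSpace}

/-- The element `w 0 ⊗ ⋯ ⊗ w (n - 1)` of `Hⁿ` given by the first terms of a sequence. -/
def seqElt (n : ℕ) (w : ℕ → H) : (obj (C := SuperSpace) H n).carrier :=
  tensorElt H n fun i => w i

theorem seqElt_congr {n : ℕ} {w w' : ℕ → H} (h : ∀ p < n, w p = w' p) :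
    seqElt n w = seqElt n w' :=
  congrArg (tensorElt H n) (funext fun i => h i i.2)

theorem tmul_seqElt {n : ℕ} {w w' : ℕ → H} (h : ∀ p < n, w p = w' (p + 1)) :
    (w' 0 ⊗ₜ[ℂ] seqElt n w : (obj (C := SuperSpace) H (n + 1)).carrier) = seqElt (n + 1) w' :=
  congrArg (fun t => w' 0 ⊗ₜ[ℂ] t) (seqElt_congr h)

theorem seqElt_mem_homogeneous (n : ℕ) (w : ℕ → H) (d : ℕ → ZMod 2)
    (hw : ∀ p, w p ∈ H.homogeneous (d p)) :
    seqElt n w ∈ (obj (C := SuperSpace) H n).homogeneous (∑ p ∈ Finset.range n, d p) := by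
  induction n generalizing w d with
  | zero =>
    have h : (1 : ℂ) ∈ (𝟙_ SuperSpace).homogeneous 0 := by
      simp only [homogeneous, Module.End.mem_eigenspace_iff, ZMod.val_zero, pow_zero, one_smul]
      rfl
    rw [Finset.sum_range_zero]
    exact h
  | succ n ih =>
    rw [Finset.sum_range_succ', add_comm _ (d 0)]
    have h := ih (fun p => w (p + 1)) (fun p => d (p + 1)) fun p => hw _
    exact tmul_mem_homogeneous (V := H) (W := obj H n) (hw 0) h

theorem splitLast_seqElt (n : ℕ) (w : ℕ → H) :
    splitLast H n (seqElt (n + 1) w) =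
      (seqElt n w ⊗ₜ[ℂ] w n : (obj (C := SuperSpace) H n).carrier ⊗[ℂ] H) := by
  induction n generalizing w with
  | zero =>
    change (1 : ℂ) ⊗ₜ[ℂ] ((1 : ℂ) • w 0) = (1 : ℂ) ⊗ₜ[ℂ] w 0
    rw [one_smul]
  | succ n ih =>
    change (TensorProduct.assoc ℂ H (obj (C := SuperSpace) H n).carrier H).symm
      (w 0 ⊗ₜ splitLast H n (seqElt (n + 1) fun p => w (p + 1))) = _
    erw [ih]
    rfl

theorem concat_seqElt (m n : ℕ) (y z : ℕ → H) :
    concat H m n (seqElt m y ⊗ₜ[ℂ] seqElt n z :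
      (obj (C := SuperSpace) H m).carrier ⊗[ℂ] (obj (C := SuperSpace) H n).carrier) =
      seqElt (n + m) fun p => if p < m then y p else z (p - m) := by
  induction m generalizing y with
  | zero =>
    change (1 : ℂ) • seqElt n z = _
    rw [one_smul]
    exact seqElt_congr fun p _ => by simp
  | succ m ih =>
    change y 0 ⊗ₜ[ℂ] concat H m n (seqElt m (fun p => y (p + 1)) ⊗ₜ[ℂ] seqElt n z) = _
    rw [ih]
    exact tmul_seqElt (w' := fun p => if p < m + 1 then y p else z (p - (m + 1)))
      fun p _ => by simp

/-- Each transposed pair contributes its own Koszul sign. The result is an arbitrary sequence `w'`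
constrained pointwise, so that successive stages of `interleave` can be substituted directly. -/
theorem braidLayer_seqElt (j k N : ℕ) (hN : j + 2 * k ≤ N) (w w' : ℕ → H) (d : ℕ → ZMod 2)
    (hw : ∀ p, w p ∈ H.homogeneous (d p)) (h_lt : ∀ p < j, w' p = w p)
    (h_even : ∀ i < k, w' (j + 2 * i) = w (j + 2 * i + 1))
    (h_odd : ∀ i < k, w' (j + 2 * i + 1) = w (j + 2 * i))
    (h_ge : ∀ p, j + 2 * k ≤ p → w' p = w p) :
    braidLayer H j k N (seqElt N w) =
      (∏ i ∈ Finset.range k, (-1 : ℂ) ^ (d (j + 2 * i) * d (j + 2 * i + 1)).val) •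
        seqElt N w' := by
  induction j generalizing N w w' d with
  | zero =>
    induction k generalizing N w w' d with
    | zero =>
      have : braidLayer H 0 0 N = 𝟙 _ := by
        cases N <;> rfl
      rw [this, Finset.prod_range_zero, one_smul]
      exact seqElt_congr fun p _ => (h_ge p (by omega)).symm
    | succ k ih =>
      obtain ⟨N, rfl⟩ : ∃ M, N = M + 2 := ⟨N - 2, by omega⟩
      change TensorProduct.assoc ℂ H H (obj (C := SuperSpace) H N).carrier
        (braidLin H H (w 0 ⊗ₜ w 1) ⊗ₜ braidLayer H 0 k N (seqElt N fun p => w (p + 2))) = _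
      rw [ih N (by omega) (fun p => w (p + 2)) (fun p => w' (p + 2)) (fun p => d (p + 2))
        (fun p => hw _) nofun
        (fun i hi => by simpa [mul_add, add_right_comm] using h_even (i + 1) (by omega))
        (fun i hi => by simpa [mul_add, add_right_comm] using h_odd (i + 1) (by omega))
        (fun p hp => h_ge _ (by omega)), braidLin_homogeneous _ _ (hw 0) (hw 1)]
      rw [TensorProduct.smul_tmul_smul, map_smul, Finset.prod_range_succ', mul_comm]
      have e0 : w' 0 = w 1 := h_even 0 (by omega)
      have e1 : w' 1 = w 0 := h_odd 0 (by omega)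
      rw [← e0, ← e1]
      simp only [mul_add, zero_add, mul_one, mul_zero, add_right_comm]
      rfl
  | succ j ih =>
    obtain ⟨N, rfl⟩ : ∃ M, N = M + 1 := ⟨N - 1, by omega⟩
    have : braidLayer H (j + 1) k (N + 1) = H ◁ braidLayer H j k N := by
      cases k <;> rfl
    rw [this]
    change w 0 ⊗ₜ[ℂ] braidLayer H j k N (seqElt N fun p => w (p + 1)) = _
    rw [ih N (by omega) (fun p => w (p + 1)) (fun p => w' (p + 1)) (fun p => d (p + 1))
      (fun p => hw _) (fun p hp => h_lt _ (by omega))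
      (fun i hi => by simpa [add_right_comm] using h_even i hi)
      (fun i hi => by simpa [add_right_comm] using h_odd i hi)
      (fun p hp => h_ge _ (by omega))]
    erw [TensorProduct.tmul_smul]
    rw [← h_lt 0 (by omega)]
    simp only [add_right_comm]
    rfl

/-- The partially shuffled sequence: `j` terms of `y`, then terms of `z` and `y` alternately,
then the remaining terms of `z`, with `n` terms of each in total. -/
def interleave {X : Type*} (n j : ℕ) (y z : ℕ → X) (p : ℕ) : X :=
  if p < j then y p else
    if p < 2 * n - j then
      if (p - j) % 2 = 0 then z ((p - j) / 2) else y (j + (p - j) / 2)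
    else z (p - n)

theorem interleave_even {X : Type*} {n j i : ℕ} (y z : ℕ → X) (hi : i < n - j) :
    interleave n j y z (j + 2 * i) = z i := by
  rw [interleave, if_neg (by omega), if_pos (by omega), if_pos (by omega)]
  congr 1; omega

theorem interleave_odd {X : Type*} {n j i : ℕ} (y z : ℕ → X) (hi : i < n - j) :
    interleave n j y z (j + 2 * i + 1) = y (j + i) := by
  rw [interleave, if_neg (by omega), if_pos (by omega), if_neg (by omega)]
  congr 1; omega

theorem interleave_succ_even {X : Type*} {n j i : ℕ} (y z : ℕ → X) (hi : i < n - j) :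
    interleave n (j + 1) y z (j + 2 * i) = y (j + i) := by
  rw [interleave]
  split_ifs
  · congr 1; omega
  · omega
  · congr 1; omega
  · omega

theorem interleave_succ_odd {X : Type*} {n j i : ℕ} (y z : ℕ → X) (hi : i < n - j) :
    interleave n (j + 1) y z (j + 2 * i + 1) = z i := by
  rw [interleave, if_neg (by omega)]
  split_ifs
  · congr 1; omega
  · omega
  · congr 1; omega

theorem interleave_lt {X : Type*} {n j p : ℕ} (y z : ℕ → X) (hp : p < j) :
    interleave n j y z p = y p := if_pos hp

theorem interleave_ge {X : Type*} {n j p : ℕ} (y z : ℕ → X) (h₁ : j ≤ p) (h₂ : 2 * n - j ≤ p) :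
    interleave n j y z p = z (p - n) := by
  rw [interleave, if_neg (by omega), if_neg (by omega)]

theorem interleave_rel {X Y : Type*} {R : X → Y → Prop} {n j : ℕ} {y z : ℕ → X} {e d : ℕ → Y}
    (hy : ∀ p, R (y p) (e p)) (hz : ∀ p, R (z p) (d p)) (p : ℕ) :
    R (interleave n j y z p) (interleave n j e d p) := by
  unfold interleave
  split_ifs
  exacts [hy _, hz _, hy _, hz _]

/-- The composite of the first `m` layers of the shuffle. -/
noncomputable def braidLayers (H : SuperSpace) (n : ℕ) : ℕ → (obj H (n + n) ⟶ obj H (n + n))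
  | 0 => 𝟙 _
  | m + 1 => braidLayer H (m + 1) (n - (m + 1)) (n + n) ≫ braidLayers H n m

theorem shuffle_eq_braidLayers (n : ℕ) : shuffle H n = braidLayers H n (n - 1) := by
  unfold shuffle
  generalize n - 1 = m
  induction m with
  | zero => rfl
  | succ m ih =>
    -- Multiplication in `End` composes right to left, so the last factor of the list product is the
    -- layer applied first.
    rw [List.range_succ, List.map_append, List.prod_append, List.map_singleton,
      List.prod_singleton, End.mul_def, ih]
    rfl

/-- The layer j = m + 1 takes stage j + 1 of `interleave` to stage j by exchanging y_{j+i} with z_i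
for every i < n - m, which accounts for one inner product of signs. -/
theorem braidLayers_seqElt (n m : ℕ) (hm : m ≤ n) (y z : ℕ → H) (e d : ℕ → ZMod 2)
    (hy : ∀ p, y p ∈ H.homogeneous (e p)) (hz : ∀ p, z p ∈ H.homogeneous (d p)) :
    braidLayers H (n + 1) m (seqElt (n + 1 + (n + 1)) (interleave (n + 1) (m + 1) y z)) =
      (∏ m ∈ Finset.range m, ∏ i ∈ Finset.range (n - m),
        (-1 : ℂ) ^ (e (m + 1 + i) * d i).val) •
        seqElt (n + 1 + (n + 1)) (interleave (n + 1) 1 y z) := by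
  induction m with
  | zero =>
    rw [Finset.prod_range_zero, one_smul]
    rfl
  | succ m ih =>
    have hl := braidLayer_seqElt (m + 1) (n + 1 - (m + 1)) (n + 1 + (n + 1)) (by omega)
      (interleave (n + 1) (m + 1 + 1) y z) (interleave (n + 1) (m + 1) y z)
      (interleave (n + 1) (m + 1 + 1) e d) (interleave_rel (R := fun v a => v ∈ H.homogeneous a) hy hz)
      (fun p hp => by rw [interleave_lt _ _ hp, interleave_lt _ _ (by omega)])
      (fun i hi => by rw [interleave_even _ _ hi, interleave_succ_odd _ _ hi])
      (fun i hi => by rw [interleave_odd _ _ hi, interleave_succ_even _ _ hi])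
      (fun p hp => by
        rw [interleave_ge _ _ (by omega) (by omega), interleave_ge _ _ (by omega) (by omega)])
    change braidLayers H (n + 1) m (braidLayer H (m + 1) (n + 1 - (m + 1)) _ _) = _
    rw [hl, map_smul, ih (by omega), smul_smul,
      Finset.prod_range_succ, mul_comm, Nat.add_sub_add_right]
    congr 2
    refine Finset.prod_congr rfl fun i hi => ?_
    have hi' : i < n + 1 - (m + 1) := by simpa using hi
    rw [interleave_succ_even _ _ hi', interleave_succ_odd _ _ hi']

variable [HopfObj H]

theorem mulPairs_seqElt (n N : ℕ) (hN : N = n + n) (w : ℕ → H) :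
    mulPairs H n N hN (seqElt N w) =
      seqElt n fun i => mulElt H (w (2 * i)) (w (2 * i + 1)) := by
  induction n generalizing N w with
  | zero => subst hN; rfl
  | succ n ih =>
    obtain ⟨N, rfl⟩ : ∃ M, N = M + 2 := ⟨N - 2, by omega⟩
    change mulElt H (w 0) (w 1) ⊗ₜ[ℂ] mulPairs H n N _ (seqElt N fun p => w (p + 2)) = _
    rw [ih]
    rfl

theorem mulPow_seqElt (n : ℕ) (y z : ℕ → H) (e d : ℕ → ZMod 2)
    (hy : ∀ p, y p ∈ H.homogeneous (e p)) (hz : ∀ p, z p ∈ H.homogeneous (d p)) :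
    mulPow H (n + 1) (seqElt (n + 1) y ⊗ₜ[ℂ] seqElt (n + 1) z :
      (obj (C := SuperSpace) H (n + 1)).carrier ⊗[ℂ] (obj (C := SuperSpace) H (n + 1)).carrier) =
      (∏ m ∈ Finset.range n, ∏ i ∈ Finset.range (n - m),
        (-1 : ℂ) ^ (e (m + 1 + i) * d i).val) •
        seqElt (n + 1) fun i => mulElt H (y i) (z i) := by
  -- At stage n + 1 the alternating zone is empty, so `interleave` is plain concatenation.
  have h : seqElt (n + 1 + (n + 1)) (fun p => if p < n + 1 then y p else z (p - (n + 1))) =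
      seqElt (n + 1 + (n + 1)) (interleave (n + 1) (n + 1) y z) := seqElt_congr fun p _ => by
    unfold interleave
    split_ifs <;> first | rfl | omega
  rw [mulPow, shuffle_eq_braidLayers]
  change mulPairs H (n + 1) _ rfl (braidLayers H (n + 1) n (concat H (n + 1) (n + 1) _)) = _
  rw [concat_seqElt, h, braidLayers_seqElt n n le_rfl y z e d hy hz, map_smul, mulPairs_seqElt]
  congr 1
  refine seqElt_congr fun i hi => ?_
  congr 1
  · rcases i with _ | i
    · rfl
    · have := interleave_odd (n := n + 1) (j := 1) (i := i) y z (by omega)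
      rw [show 2 * (i + 1) = 1 + 2 * i + 1 by ring, this, add_comm]
  · rcases Nat.lt_or_ge i n with h | h
    · have := interleave_even (n := n + 1) (j := 1) (i := i) y z (by omega)
      rw [← this, add_comm 1]
    -- The last z, at position 2n + 1, lies in the tail that no layer touches.
    · rw [interleave_ge _ _ (by omega) (by omega)]
      congr 1; omega

/-- Moving x_{n+1} to the front past x_0 ⊗ ⋯ ⊗ x_n costs the sign of its degree times the total
degree of that block; the rest is the reversal of the shorter block. The antipodes act after the
crossings, so only the degrees of the original entries enter. -/
theorem twistedReverse_seqElt (δ : H ⟶ 𝟙_ SuperSpace) (n : ℕ) (x : ℕ → H) (e : ℕ → ZMod 2)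
    (hx : ∀ p, x p ∈ H.homogeneous (e p)) :
    twistedReverse H δ n (seqElt (n + 1) x) =
      (∏ i ∈ Finset.range n, (-1 : ℂ) ^ ((∑ j ∈ Finset.range (i + 1), e j) * e (i + 1)).val) •
        seqElt (n + 1) fun p => if p < n then HopfObj.antipode (X := H) (x (n - p)) else
          twistedAntipode H δ (x 0) := by
  induction n with
  | zero =>
    rw [Finset.prod_range_zero, one_smul]
    rfl
  | succ n ih =>
    change TensorProduct.map (HopfObj.antipode (X := H)).toLin (twistedReverse H δ n).toLin
      (braidLin (obj H (n + 1)) H (splitLast H (n + 1) (seqElt (n + 2) x))) = _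
    erw [splitLast_seqElt]
    rw [braidLin_homogeneous _ _ (seqElt_mem_homogeneous (n + 1) x e hx) (hx (n + 1)), map_smul,
      TensorProduct.map_tmul, ih, TensorProduct.tmul_smul, smul_smul, Finset.prod_range_succ,
      mul_comm]
    congr 1
    exact tmul_seqElt (w' := fun p => if p < n + 1 then HopfObj.antipode (X := H) (x (n + 1 - p))
      else twistedAntipode H δ (x 0)) fun p _ => by simp

end ConnesMoscovici

/-! ### Matching the signs with α and β, and the explicit cyclic map. -/

namespace ConnesMoscovici

open SuperSpace

/-- Extension of a finite family by zero to a sequence. -/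
def extendZero {X : Type*} [Zero X] {n : ℕ} (x : Fin n → X) (p : ℕ) : X :=
  if h : p < n then x ⟨p, h⟩ else 0

@[simp] theorem extendZero_val {X : Type*} [Zero X] {n : ℕ} (x : Fin n → X) (i : Fin n) :
    extendZero x i = x i := dif_pos i.2

theorem extendZero_of_lt {X : Type*} [Zero X] {n p : ℕ} (x : Fin n → X) (h : p < n) :
    extendZero x p = x ⟨p, h⟩ := dif_pos h

variable {H : SuperSpace}

theorem extendZero_mem_homogeneous {n : ℕ} {x : Fin n → H} {e : Fin n → ZMod 2}
    (hx : ∀ i, x i ∈ H.homogeneous (e i)) (p : ℕ) :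
    extendZero x p ∈ H.homogeneous (extendZero e p) := by
  unfold extendZero
  split_ifs
  exacts [hx _, Submodule.zero_mem _]

theorem seqElt_eq_tensorElt {n : ℕ} {w : ℕ → H} {x : Fin n → H} (h : ∀ i : Fin n, w i = x i) :
    seqElt n w = tensorElt H n x :=
  congrArg (tensorElt H n) (funext h)

theorem signAlpha_eq {n : ℕ} (e : Fin (n + 1) → ZMod 2) :
    signAlpha e = ∏ i ∈ Finset.range n, (-1 : ℂ) ^
      ((∑ j ∈ Finset.range (i + 1), extendZero e j) * extendZero e (i + 1)).val := by
  rw [signAlpha, Finset.prod_range]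
  refine Finset.prod_congr rfl fun i _ => ?_
  have h : ∑ j ∈ Finset.Iic i.castSucc, e j = ∑ j ∈ Finset.range (i + 1), extendZero e j := by
    have hr : Finset.range (i + 1) = (Finset.Iic i.castSucc).map Fin.valEmbedding := by
      rw [Fin.map_valEmbedding_Iic]
      ext j
      simp
    rw [hr, Finset.sum_map]
    simp
  rw [h, ← Fin.val_succ, extendZero_val]

/-- Both sides run over the same crossings. β collects them by the crossing factor x_j, the shuffle
by its layers; the factor crossing z_i in layer m + 1 is y_{m+1+i}, that is, x_j with j = n - (m + 1
+ i). -/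
theorem signBeta_eq {n : ℕ} (e d : Fin (n + 1) → ZMod 2) :
    signBeta e d = ∏ m ∈ Finset.range n, ∏ i ∈ Finset.range (n - m),
      (-1 : ℂ) ^ (extendZero e (n - (m + 1 + i)) * extendZero d (i + 1)).val := by
  have h : signBeta e d = ∏ j ∈ Finset.range n, ∏ i ∈ Finset.range (n - j),
      (-1 : ℂ) ^ (extendZero e j * extendZero d (i + 1)).val := by
    rw [signBeta, Finset.prod_range]
    refine Finset.prod_congr rfl fun j _ => ?_
    have hs : ∑ l ∈ Finset.Ioc 0 j.castSucc.rev, d l =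
        ∑ i ∈ Finset.range (n - j), extendZero d (i + 1) := by
      have hr : Finset.Ico (0 + 1) (n - j + 1) =
          (Finset.Ioc 0 j.castSucc.rev).map Fin.valEmbedding := by
        rw [Fin.map_valEmbedding_Ioc]
        ext l
        simp only [Finset.mem_Ico, Finset.mem_Ioc, Fin.val_rev, Fin.val_castSucc, Fin.val_zero]
        omega
      rw [Finset.range_eq_Ico, Finset.sum_Ico_add' (extendZero d) 0 (n - j) 1, hr, Finset.sum_map]
      simp
    rw [hs, Finset.mul_sum, neg_one_pow_val_sum, ← Fin.val_castSucc, extendZero_val]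
  rw [h, Finset.prod_sigma', Finset.prod_sigma']
  -- For fixed i, the passage between j and m is j = n - (m + 1 + i), which is its own inverse on
  -- the range i < n - m.
  refine Finset.prod_nbij' (fun a => ⟨n - (a.1 + 1 + a.2), a.2⟩)
    (fun a => ⟨n - (a.1 + 1 + a.2), a.2⟩) ?_ ?_ ?_ ?_ ?_
  · rintro ⟨a, b⟩ h
    simp only [Finset.mem_sigma, Finset.mem_range] at h ⊢
    omega
  · rintro ⟨a, b⟩ h
    simp only [Finset.mem_sigma, Finset.mem_range] at h ⊢
    omega
  · rintro ⟨a, b⟩ h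
    simp only [Finset.mem_sigma, Finset.mem_range] at h
    simp only [Sigma.mk.injEq, heq_eq_eq, and_true]
    omega
  · rintro ⟨a, b⟩ h
    simp only [Finset.mem_sigma, Finset.mem_range] at h
    simp only [Sigma.mk.injEq, heq_eq_eq, and_true]
    omega
  · rintro ⟨a, b⟩ h
    simp only [Finset.mem_sigma, Finset.mem_range] at h
    rw [show n - (n - (a + 1 + b) + 1 + b) = a by omega]

variable [HopfObj H]

theorem cyclic_tensorElt (δ : H ⟶ 𝟙_ SuperSpace) (σ : 𝟙_ SuperSpace ⟶ H) (n : ℕ)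
    (h : Fin (n + 1) → H) (d : Fin (n + 1) → ZMod 2) (hd : ∀ l, h l ∈ H.homogeneous (d l))
    (r : ℕ) (x : Fin r → Fin (n + 1) → H) (e : Fin r → Fin (n + 1) → ZMod 2)
    (he : ∀ k j, x k j ∈ H.homogeneous (e k j))
    (hx : iterComul H n (h 0) = ∑ k, tensorElt H (n + 1) (x k)) :
    cyclic H δ σ (n + 1) (tensorElt H (n + 1) h) =
      ∑ k, (signAlpha (e k) * signBeta (e k) d) • tensorElt H (n + 1)
        (Fin.snoc (fun i : Fin n => mulElt H (HopfObj.antipode (X := H) (x k i.castSucc.rev))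
            (h i.succ))
          (mulElt H (twistedAntipode H δ (x k 0)) (elt σ)) : Fin (n + 1) → H) := by
  have hS : (twistedAntipode H δ ≫ iterComul H n) (h 0) =
      ∑ k, twistedReverse H δ n (tensorElt H (n + 1) (x k)) := by
    rw [twistedAntipode_iterComul, ← map_sum, ← hx]
    rfl
  change mulPow H (n + 1) ((twistedAntipode H δ ≫ iterComul H n) (h 0) ⊗ₜ[ℂ]
    snocCochar H σ n (tensorElt H n (Fin.tail h)) :
      (obj (C := SuperSpace) H (n + 1)).carrier ⊗[ℂ] (obj (C := SuperSpace) H (n + 1)).carrier) = _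
  rw [hS, TensorProduct.sum_tmul]
  refine (map_sum (mulPow H (n + 1)).toLin _ _).trans (Finset.sum_congr rfl fun k _ => ?_)
  have hσ : elt σ ∈ H.homogeneous 0 := apply_mem_homogeneous σ (by
    simp only [homogeneous, Module.End.mem_eigenspace_iff, ZMod.val_zero, pow_zero, one_smul]
    rfl)
  have hz : snocCochar H σ n (tensorElt H n (Fin.tail h)) = seqElt (n + 1)
      (extendZero (Fin.snoc (Fin.tail h) (elt σ) : Fin (n + 1) → H)) := by
    rw [snocCochar_tensorElt]
    exact (seqElt_eq_tensorElt (extendZero_val _)).symm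
  have hx' : tensorElt H (n + 1) (x k) = seqElt (n + 1) (extendZero (x k)) :=
    (seqElt_eq_tensorElt (extendZero_val _)).symm
  -- Truncated subtraction gives n - p = 0 for all p ≥ n, which agrees with the entry `x k 0` in the
  -- second branch.
  have hy : ∀ p, (if p < n then HopfObj.antipode (X := H) (extendZero (x k) (n - p)) else
      twistedAntipode H δ (extendZero (x k) 0)) ∈ H.homogeneous (extendZero (e k) (n - p)) := by
    intro p
    split_ifs with hp
    · exact apply_mem_homogeneous _ (extendZero_mem_homogeneous (he k) _)
    · rw [show n - p = 0 by omega]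
      exact apply_mem_homogeneous _ (extendZero_mem_homogeneous (he k) _)
  have hz' : ∀ p, extendZero (Fin.snoc (Fin.tail h) (elt σ) : Fin (n + 1) → H) p ∈
      H.homogeneous (extendZero (Fin.snoc (Fin.tail d) 0 : Fin (n + 1) → ZMod 2) p) :=
    extendZero_mem_homogeneous fun i => by
      induction i using Fin.lastCases with
      | last => simpa using hσ
      | cast i => simpa [Fin.tail] using hd i.succ
  rw [hz, hx', twistedReverse_seqElt δ n _ _ (extendZero_mem_homogeneous (he k)),
    ← TensorProduct.smul_tmul']
  refine (map_smul (mulPow H (n + 1)).toLin _ _).trans ?_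
  refine (congrArg _ (mulPow_seqElt n _ _ _ _ hy hz')).trans ?_
  rw [smul_smul, ← signAlpha_eq, signBeta_eq]
  congr 1
  · congr 1
    -- Since i < n - m ≤ n, only the z_i before σ occur, and z_i is the entry of h with zero-based
    -- index i + 1.
    refine Finset.prod_congr rfl fun m hm => Finset.prod_congr rfl fun i hi => ?_
    rw [Finset.mem_range] at hm hi
    rw [extendZero_of_lt (p := i) _ (by omega), extendZero_of_lt (p := i + 1) _ (by omega),
      show (⟨i, by omega⟩ : Fin (n + 1)) = Fin.castSucc ⟨i, by omega⟩ from rfl, Fin.snoc_castSucc]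
    rfl
  · refine seqElt_eq_tensorElt fun i => ?_
    rw [extendZero_val]
    induction i using Fin.lastCases with
    | last =>
      rw [Fin.snoc_last, Fin.snoc_last, if_neg (by simp)]
      rfl
    | cast i =>
      rw [Fin.snoc_castSucc, Fin.snoc_castSucc, if_pos (by simp), extendZero_of_lt _ (by omega)]
      congr 3
      exact Fin.ext (by simp)

end ConnesMoscovici

theorem mainTheorem10 (H : SuperSpace) [HopfObj H]
    (δ : H ⟶ 𝟙_ SuperSpace) (σ : 𝟙_ SuperSpace ⟶ H)
    (hMPI : ConnesMoscovici.IsBraidedMPI H δ σ) :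
    -- the complex: `C⁰(H) = ℂ`, and `Cⁿ(H)` is the `n`-th tensor power of `H`
    ConnesMoscovici.obj H 0 = 𝟙_ SuperSpace ∧
    (∀ n : ℕ, ∃ e : (ConnesMoscovici.obj (C := SuperSpace) H n).carrier ≃ₗ[ℂ] (⨂[ℂ] _ : Fin n, H),
      ∀ h : Fin n → H, e (ConnesMoscovici.tensorElt H n h) = PiTensorProduct.tprod ℂ h) ∧
    -- the faces `δ_0`, `δ_i` for `1 ≤ i ≤ n`, and `δ_{n+1}` from `Cⁿ(H)` to `Cⁿ⁺¹(H)`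
    (∀ (n : ℕ) (h : Fin n → H),
      ConnesMoscovici.face H σ n 0 (ConnesMoscovici.tensorElt H n h) =
        ConnesMoscovici.tensorElt H (n + 1) (Fin.cons (ConnesMoscovici.oneElt H) h : Fin (n + 1) → H)) ∧
    (∀ (n : ℕ) (h : Fin n → H) (i : Fin n) (r : ℕ) (x y : Fin r → H),
      ConnesMoscovici.comulElt H (h i) = ∑ k, x k ⊗ₜ[ℂ] y k →
      ConnesMoscovici.face H σ n i.castSucc.succ (ConnesMoscovici.tensorElt H n h) =
        ∑ k, ConnesMoscovici.tensorElt H (n + 1)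
          (i.castSucc.insertNth (x k) (Function.update h i (y k)) : Fin (n + 1) → H)) ∧
    (∀ (n : ℕ) (h : Fin n → H),
      ConnesMoscovici.face H σ n (Fin.last (n + 1)) (ConnesMoscovici.tensorElt H n h) =
        ConnesMoscovici.tensorElt H (n + 1)
          (Fin.snoc h (ConnesMoscovici.elt σ) : Fin (n + 1) → H)) ∧
    -- the degeneracies `σ_i` for `0 ≤ i ≤ n` from `Cⁿ⁺¹(H)` to `Cⁿ(H)`
    (∀ (n : ℕ) (h : Fin (n + 1) → H) (i : Fin (n + 1)),
      ConnesMoscovici.degeneracy H n i (ConnesMoscovici.tensorElt H (n + 1) h) =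
        ConnesMoscovici.counitElt H (h i) • ConnesMoscovici.tensorElt H n (i.removeNth h)) ∧
    -- the cyclic map in degree `0`
    ConnesMoscovici.cyclic H δ σ 0 = 𝟙 (ConnesMoscovici.obj H 0) ∧
    -- every element has a Sweedler expansion `Δⁿ a = ∑ a⁽¹⁾ ⊗ ⋯ ⊗ a⁽ⁿ⁺¹⁾` with homogeneous entries
    (∀ (n : ℕ) (a : H), ∃ (r : ℕ) (x : Fin r → Fin (n + 1) → H) (e : Fin r → Fin (n + 1) → ZMod 2),
      (∀ k j, x k j ∈ H.homogeneous (e k j)) ∧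
      ConnesMoscovici.iterComul H n a = ∑ k, ConnesMoscovici.tensorElt H (n + 1) (x k)) ∧
    -- the cyclic map in degree `n + 1`, on homogeneous `h_1, …, h_{n+1}`, for every such expansion
    (∀ (n : ℕ) (h : Fin (n + 1) → H) (d : Fin (n + 1) → ZMod 2),
      (∀ l, h l ∈ H.homogeneous (d l)) →
      ∀ (r : ℕ) (x : Fin r → Fin (n + 1) → H) (e : Fin r → Fin (n + 1) → ZMod 2),
      (∀ k j, x k j ∈ H.homogeneous (e k j)) →
      ConnesMoscovici.iterComul H n (h 0) = ∑ k, ConnesMoscovici.tensorElt H (n + 1) (x k) →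
      ConnesMoscovici.cyclic H δ σ (n + 1) (ConnesMoscovici.tensorElt H (n + 1) h) =
        ∑ k, (ConnesMoscovici.signAlpha (e k) * ConnesMoscovici.signBeta (e k) d) •
          ConnesMoscovici.tensorElt H (n + 1)
            (Fin.snoc
              (fun i : Fin n =>
                ConnesMoscovici.mulElt H (HopfObj.antipode (X := H) (x k i.castSucc.rev))
                  (h i.succ))
              (ConnesMoscovici.mulElt H (ConnesMoscovici.twistedAntipode H δ (x k 0))
                (ConnesMoscovici.elt σ)) : Fin (n + 1) → H)) := by
  refine ⟨rfl, fun n => ⟨_, (ConnesMoscovici.objEquiv H n).2⟩,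
    ConnesMoscovici.face_zero_tensorElt σ, fun n h i r x y hxy => ?_, fun n h => ?_,
    ConnesMoscovici.degeneracy_tensorElt, rfl,
    fun n a => ConnesMoscovici.exists_homogeneous_expansion n _,
    ConnesMoscovici.cyclic_tensorElt δ σ⟩
  · rw [ConnesMoscovici.face, Fin.cases_succ, Fin.lastCases_castSucc]
    exact ConnesMoscovici.comulAt_tensorElt n h i r x y hxy
  -- The top index is the successor of a last element, which selects the σ-branch of the nested case
  -- distinction in `face`.
  · rw [← Fin.succ_last, ConnesMoscovici.face, Fin.cases_succ, Fin.lastCases_last]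
    exact ConnesMoscovici.snocCochar_tensorElt σ n h
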